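/- For a set $S\subseteq\mathbb{R}^d$, the Helly number $h(S)$ is the smallest nonnegative integer $h$ such that the following holds: for every finite family $\mathcal{F}$ of convex sets in $\mathbb{R}^d$, if every $h$ or fewer sets in $\mathcal{F}$ have a point of $S$ in their intersection, then the intersection of all sets in $\mathcal{F}$ contains a point of $S$. If no such $h$ exists, then $h(S)=\infty$. For $\alpha>1$ let $L_2(\alpha)=\{\alpha^n : n\in\mathbb{N}_0\}^2\subseteq\mathbb{R}^2$, where $\mathbb{N}_0=\{0,1,2,\dots\}$. Theorem. For every real $\alpha>1$, \[ h(L_2(\alpha))\le 2\left\lceil\log_{\alpha}\left(\frac{\alpha}{\alpha-1}\right)\right\rceil+3 . \] -/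

import Mathlib

/-- The Helly-type property of a set `S` with parameter `h`: for every finite family `F` of convex
sets, if every subfamily of at most `h` members has a point of `S` in its intersection, then the
intersection of the whole family contains a point of `S`. The intersection of the empty subfamily
is the whole space. -/
def HellyProperty {E : Type*} [AddCommGroup E] [Module ℝ E] (S : Set E) (h : ℕ) : Prop :=
  ∀ F : Finset (Set E), (∀ X ∈ F, Convex ℝ X) →
    (∀ G : Finset (Set E), G ⊆ F → G.card ≤ h → ∃ x ∈ S, ∀ X ∈ G, x ∈ X) →
    ∃ x ∈ S, ∀ X ∈ F, x ∈ X

/-- The Helly number of `S`: the least `h` with the Helly-type property, and `⊤` if there is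
none. -/
noncomputable def hellyNumber {E : Type*} [AddCommGroup E] [Module ℝ E] (S : Set E) : ℕ∞ :=
  ⨅ (h : ℕ) (_ : HellyProperty S h), (h : ℕ∞)

/-- The exponential lattice `{α ^ n : n ∈ ℕ} ^ d` in `ℝ ^ d`, where `ℕ` contains `0`. -/
def expLattice (d : ℕ) (α : ℝ) : Set (Fin d → ℝ) :=
  {x | ∀ i, ∃ n : ℕ, x i = α ^ n}

/-! By Hoffman's reduction, failure of the Helly property at `h` yields more than `h` lattice points
whose subfamilies have no further lattice point in their hulls. It remains to bound such an empty
set, and emptiness of triangles is enough.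

In exponents, a point with coordinates `(a, b)` has homogeneous coordinates `(1 : α ^ a : α ^ b)`,
so cyclic permutation of these is a symmetry (`rotate`), once negative exponents are allowed. If
none of the three charts contains a strictly decreasing pair, any two points share a row in some
chart; rows hold at most two points, so there are at most four points.

Otherwise, in some chart, either there are at most four points or the whole set is weakly decreasing
(`antitone_of_decreasing_pair`). In the latter case take its top-left and bottom-right ends `p`,
`q`. Emptiness allows one point per column on each side of the line `pq`. Because `1 - 1/α ≥ α ^
(-k)`, these points lie in about `k` columns next to `q`: at most `k` below the line, and `k` above
it plus one in the top row. With `p` and `q` this gives `2 * k + 3` (`card_le_of_antitone`). -/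

/-! ### Convex hulls and Hoffman's reduction -/

/-- The anti-exchange property of convex hulls. -/
theorem eq_of_mem_convexHull_insert {E : Type*} [AddCommGroup E] [Module ℝ E] {C : Set E}
    (hC : C.Nonempty) {p q : E} (hp : p ∈ convexHull ℝ (insert q C))
    (hq : q ∈ convexHull ℝ (insert p C)) (hpC : p ∉ convexHull ℝ C) : p = q := by
  rw [convexHull_insert hC, convexJoin_singleton_left] at hp hq
  simp only [Set.mem_iUnion] at hp hq
  obtain ⟨c, hc, hp⟩ := hp
  obtain ⟨d, hd, hq⟩ := hq
  obtain ⟨a, b, ha, hb, hab, rfl⟩ := hp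
  obtain ⟨a', b', ha', hb', hab', hq⟩ := hq
  by_contra hne
  apply hpC
  have ha1 : a ≤ 1 := by linarith
  have ha1' : a' ≤ 1 := by linarith
  have hlt : a * a' < 1 := by
    rcases lt_or_eq_of_le (mul_le_one₀ ha1 ha' ha1') with h | h
    · exact h
    · exfalso
      have : a = 1 := by nlinarith
      have : b = 0 := by linarith
      subst this
      apply hne
      simp [show a = 1 by linarith]
  have hpos : 0 < 1 - a * a' := by linarith
  set p := a • q + b • c with hp
  -- Eliminating `q` from the two convex combinations exhibits `p` as a combination of `c` and `d`
  -- alone.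
  have key : p = (a * b' / (1 - a * a')) • d + (b / (1 - a * a')) • c := by
    have h1 : (1 - a * a') • p = (a * b') • d + b • c := by
      have : p = a • (a' • p + b' • d) + b • c := by rw [hq]
      rw [sub_smul, one_smul]
      nth_rewrite 1 [this]
      module
    have h2 : p = (1 - a * a')⁻¹ • ((a * b') • d + b • c) := by
      rw [← h1, smul_smul, inv_mul_cancel₀ hpos.ne', one_smul]
    rw [h2]
    module
  rw [key]
  refine convex_convexHull ℝ C hd hc (by positivity) (by positivity) ?_
  rw [← add_div, div_eq_one_iff_eq hpos.ne']
  have e1 : b' = 1 - a' := by linarith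
  have e2 : b = 1 - a := by linarith
  rw [e1, e2]; ring

/-- Hoffman's reduction: if the Helly-type property fails for a set which meets the convex hull of
each of its finite subsets in a finite set, then there are more than `h` points of that set, no
further point of which lies in the hull of any of their subfamilies. -/
theorem exists_empty_finset_of_not_hellyProperty {E : Type*} [AddCommGroup E] [Module ℝ E]
    {S : Set E} (hfin : ∀ T : Set E, T.Finite → T ⊆ S → (S ∩ convexHull ℝ T).Finite) {h : ℕ}
    (hS : ¬ HellyProperty S h) :
    ∃ Q : Finset E, h < Q.card ∧ (Q : Set E) ⊆ S ∧
      ∀ A ⊆ (Q : Set E), S ∩ convexHull ℝ A ⊆ A := by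
  classical
  unfold HellyProperty at hS
  push Not at hS
  obtain ⟨F, hFc, hFh, hF⟩ := hS
  -- a minimal subfamily without a common point in `S`
  obtain ⟨G, ⟨hGF, hG⟩, hmin⟩ : ∃ G : Finset (Set E),
      Minimal (fun G => G ⊆ F ∧ ∀ x ∈ S, ∃ X ∈ G, x ∉ X) G :=
    exists_minimal_of_wellFoundedLT _ ⟨F, subset_rfl, hF⟩
  have hGh : h < G.card := by
    by_contra hle
    obtain ⟨x, hxS, hx⟩ := hFh G hGF (not_lt.mp hle)
    obtain ⟨X, hX, hxX⟩ := hG x hxS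
    exact hxX (hx X hX)
  have hpt : ∀ t : G, ∃ x ∈ S, ∀ s : G, s ≠ t → x ∈ s.1 := by
    intro t
    by_contra hcon
    push Not at hcon
    have := hmin (y := G.erase t.1) ⟨(Finset.erase_subset _ _).trans hGF, fun x hx => by
      obtain ⟨s, hs, hxs⟩ := hcon x hx
      exact ⟨s.1, Finset.mem_erase.mpr ⟨fun e => hs (Subtype.ext e), s.2⟩, hxs⟩⟩
      (Finset.erase_subset _ _)
    exact Finset.notMem_erase t.1 G (this t.2)
  choose a haS ha using hpt
  set P : Set E := S ∩ convexHull ℝ (Set.range a) with hP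
  have hPfin : P.Finite := hfin _ (Set.finite_range a) (by rintro _ ⟨t, rfl⟩; exact haS t)
  have haP : ∀ t, a t ∈ P := fun t => ⟨haS t, subset_convexHull ℝ _ ⟨t, rfl⟩⟩
  -- a maximal family of convex traces on `P` with empty intersection
  let good : Set (G → Set E) := {C | (∀ t, C t ⊆ P) ∧ (∀ t, P ∩ convexHull ℝ (C t) ⊆ C t) ∧
    (∀ t s, s ≠ t → a t ∈ C s) ∧ ∀ p ∈ P, ∃ t, p ∉ C t}
  have hgfin : good.Finite :=
    (Set.Finite.pi' (fun _ : G => hPfin.finite_subsets)).subset fun C hC t => hC.1 t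
  have hgne : good.Nonempty := by
    refine ⟨fun t => P ∩ t.1, fun t => Set.inter_subset_left, fun t x hx => ⟨hx.1, ?_⟩,
      fun t s hst => ⟨haP t, ha t s hst⟩, fun p hp => ?_⟩
    · exact convexHull_min Set.inter_subset_right (hFc _ (hGF t.2)) hx.2
    · obtain ⟨X, hX, hpX⟩ := hG p hp.1
      exact ⟨⟨X, hX⟩, fun hh => hpX hh.2⟩
  obtain ⟨C, ⟨hCP, hCc, hCa, hCe⟩, hmax⟩ := hgfin.exists_maximal hgne
  -- `D t` consists of the points that only `C t` excludes.
  let D : G → Set E := fun t => {p | p ∈ P ∧ ∀ s, s ≠ t → p ∈ C s}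
  have hDC : ∀ t, ∀ p ∈ D t, p ∉ C t := by
    intro t p hp hpt
    obtain ⟨s, hs⟩ := hCe p hp.1
    by_cases hst : s = t
    · exact hs (hst ▸ hpt)
    · exact hs (hp.2 s hst)
  -- Choose `q` in `D t` with `convexHull ℝ (insert q (C t))` minimal for inclusion.
  have hq : ∀ t, ∃ q ∈ D t, ∀ d ∈ D t, d ∈ convexHull ℝ (insert q (C t)) →
      q ∈ convexHull ℝ (insert d (C t)) := by
    intro t
    have hDfin : (D t).Finite := hPfin.subset fun p hp => hp.1
    obtain ⟨q, hq⟩ := hDfin.exists_minimalFor (fun q => convexHull ℝ (insert q (C t))) _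
      ⟨a t, haP t, fun s hs => hCa t s hs⟩
    refine ⟨q, hq.1, fun d hd hdq => ?_⟩
    have hle : convexHull ℝ (insert d (C t)) ⊆ convexHull ℝ (insert q (C t)) :=
      convexHull_min (Set.insert_subset hdq ((Set.subset_insert _ _).trans
        (subset_convexHull ℝ _))) (convex_convexHull ℝ _)
    exact hq.2 hd hle (subset_convexHull ℝ _ (Set.mem_insert _ _))
  choose q hqD hq using hq
  have hqinj : Function.Injective q := by
    intro s t hst
    by_contra hne
    exact hDC t _ (hqD t) (hst ▸ (hqD s).2 t (Ne.symm hne))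
  refine ⟨Finset.univ.image q, ?_, ?_, ?_⟩
  · rw [Finset.card_image_of_injective _ hqinj]
    simpa using hGh
  · intro x hx
    simp only [Finset.coe_image, Finset.coe_univ, Set.image_univ, Set.mem_range] at hx
    obtain ⟨t, rfl⟩ := hx
    exact (hqD t).1.1
  · intro A hA p hp
    by_contra hpA
    have hAP : A ⊆ P := by
      intro x hx
      have := hA hx
      simp only [Finset.coe_image, Finset.coe_univ, Set.image_univ, Set.mem_range] at this
      obtain ⟨t, rfl⟩ := this
      exact (hqD t).1
    have hpP : p ∈ P :=
      ⟨hp.1, convexHull_min (hAP.trans Set.inter_subset_right) (convex_convexHull ℝ _) hp.2⟩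
    obtain ⟨t, hpt⟩ := hCe p hpP
    have hAC : A ⊆ insert (q t) (C t) := by
      intro x hx
      have := hA hx
      simp only [Finset.coe_image, Finset.coe_univ, Set.image_univ, Set.mem_range] at this
      obtain ⟨s, rfl⟩ := this
      by_cases hst : s = t
      · exact Or.inl (by rw [hst])
      · exact Or.inr ((hqD s).2 t (Ne.symm hst))
    have hpq : p ∈ convexHull ℝ (insert (q t) (C t)) := convexHull_mono hAC hp.2
    have hpC : p ∉ convexHull ℝ (C t) := fun hh => hpt (hCc t ⟨hpP, hh⟩)
    have hne : p ≠ q t := by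
      rintro rfl
      refine hpC (convexHull_mono (fun x hx => ?_) hp.2)
      exact (hAC hx).resolve_left fun hxe => hpA (hxe ▸ hx)
    have hCne : (C t).Nonempty := by
      rw [Set.nonempty_iff_ne_empty]
      intro h0
      rw [h0] at hpq
      simp at hpq
      exact hne hpq
    -- enlarging `C t` by `p` produces a common point
    obtain ⟨d, hdD, hdp⟩ : ∃ d ∈ D t, d ∈ convexHull ℝ (insert p (C t)) := by
      by_contra hcon
      push Not at hcon
      let C' : G → Set E := Function.update C t (P ∩ convexHull ℝ (insert p (C t)))
      have hCt : C t ⊆ P ∩ convexHull ℝ (insert p (C t)) := fun x hx =>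
        ⟨hCP t hx, subset_convexHull ℝ _ (Set.mem_insert_of_mem _ hx)⟩
      have hle : C ≤ C' := by
        intro s
        by_cases hst : s = t
        · subst hst; simpa [C'] using hCt
        · simp [C', hst]
      have hC' : C' ∈ good := by
        refine ⟨fun s => ?_, fun s => ?_, fun r s hrs => hle s (hCa r s hrs), fun x hx => ?_⟩
        · by_cases hst : s = t
          · subst hst; simp [C']
          · simpa [C', hst] using hCP s
        · by_cases hst : s = t
          · subst hst
            simp only [C', Function.update_self]
            exact fun x hx => ⟨hx.1, convexHull_min Set.inter_subset_right
              (convex_convexHull ℝ _) hx.2⟩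
          · simpa [C', hst] using hCc s
        · by_contra hall
          push Not at hall
          have h1 : x ∈ D t := ⟨hx, fun s hs => by simpa [C', hs] using hall s⟩
          have h2 := hall t
          simp only [C', Function.update_self] at h2
          exact hcon x h1 h2.2
      have := hmax hC' hle t
      simp only [C', Function.update_self] at this
      exact hpt (this ⟨hpP, subset_convexHull ℝ _ (Set.mem_insert _ _)⟩)
    have hsub : convexHull ℝ (insert p (C t)) ⊆ convexHull ℝ (insert (q t) (C t)) :=
      convexHull_min (Set.insert_subset hpq ((Set.subset_insert _ _).trans
        (subset_convexHull ℝ _))) (convex_convexHull ℝ _)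
    have hdq := hq t d hdD (hsub hdp)
    have hsub' : convexHull ℝ (insert d (C t)) ⊆ convexHull ℝ (insert p (C t)) :=
      convexHull_min (Set.insert_subset hdp ((Set.subset_insert _ _).trans
        (subset_convexHull ℝ _))) (convex_convexHull ℝ _)
    -- Minimality of `q t` puts it in the hull of `d` and `C t`, hence of `p` and `C t`;
    -- anti-exchange then forces `p = q t`.
    exact hne (eq_of_mem_convexHull_insert hCne hpq (hsub' hdq) hpC)

/-! ### Empty configurations and their projective symmetry -/

/-- A finite set of exponent pairs such that the only lattice points `(α ^ a, α ^ b)` in a triangle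
spanned by the corresponding points of the plane are the vertices of the triangle. -/
def IsEmptyConfig (α : ℝ) (Q : Finset (ℤ × ℤ)) : Prop :=
  ∀ p ∈ Q, ∀ v ∈ Q, ∀ q ∈ Q, ∀ e : ℤ × ℤ, ∀ r s t : ℝ, 0 ≤ r → 0 ≤ s → 0 ≤ t → r + s + t = 1 →
    r * α ^ p.1 + s * α ^ v.1 + t * α ^ q.1 = α ^ e.1 →
    r * α ^ p.2 + s * α ^ v.2 + t * α ^ q.2 = α ^ e.2 → e = p ∨ e = v ∨ e = q

namespace IsEmptyConfig

variable {α : ℝ} {Q : Finset (ℤ × ℤ)}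

theorem swap (hE : IsEmptyConfig α Q) : IsEmptyConfig α (Q.image Prod.swap) := by
  intro p hp v hv q hq e r s t hr hs ht h1 h2 h3
  simp only [Finset.mem_image, Prod.exists, Prod.swap_prod_mk] at hp hv hq
  obtain ⟨a, b, hp, rfl⟩ := hp
  obtain ⟨c, d, hv, rfl⟩ := hv
  obtain ⟨f, g, hq, rfl⟩ := hq
  have := hE _ hp _ hv _ hq e.swap r s t hr hs ht h1 h3 h2
  obtain ⟨x, y⟩ := e
  simp only [Prod.swap_prod_mk, Prod.mk.injEq] at this ⊢
  tauto

/-- The projective symmetry of the exponential lattice which permutes the homogeneous coordinates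
cyclically. -/
def rotate (z : ℤ × ℤ) : ℤ × ℤ := (z.2 - z.1, -z.1)

theorem rotate_injective : Function.Injective rotate := by
  rintro ⟨a, b⟩ ⟨c, d⟩ h
  simp only [rotate, Prod.mk.injEq] at h ⊢
  omega

/-- In coordinates the map is `(x, y) ↦ (y / x, 1 / x)`, projective with positive denominator on the
positive quadrant. It therefore preserves triangles, after the barycentric weights are rescaled by
the denominators and normalized. -/
theorem image_rotate (hα : 1 < α) (hE : IsEmptyConfig α Q) :
    IsEmptyConfig α (Q.image rotate) := by
  have hα0 : α ≠ 0 := by positivity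
  intro p hp v hv q hq e r s t hr hs ht h1 h2 h3
  simp only [Finset.mem_image] at hp hv hq
  obtain ⟨p, hp, rfl⟩ := hp
  obtain ⟨v, hv, rfl⟩ := hv
  obtain ⟨q, hq, rfl⟩ := hq
  have key : ∀ (w : ℤ × ℤ) (r : ℝ), 0 ≤ r → 0 ≤ r * α ^ (-w.1 - e.2) := fun w r hr => by
    positivity
  have hw : ∀ (w : ℤ × ℤ) (r : ℝ), r * α ^ (-w.1 - e.2) = r * α ^ (-w.1) / α ^ e.2 := by
    intro w r
    rw [zpow_sub₀ hα0]; ring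
  have hw1 : ∀ (w : ℤ × ℤ) (r : ℝ), r * α ^ (-w.1 - e.2) * α ^ w.1 = r / α ^ e.2 := by
    intro w r
    rw [mul_assoc, ← zpow_add₀ hα0, show -w.1 - e.2 + w.1 = -e.2 by ring, zpow_neg]
    rfl
  have hw2 : ∀ (w : ℤ × ℤ) (r : ℝ),
      r * α ^ (-w.1 - e.2) * α ^ w.2 = r * α ^ (w.2 - w.1) / α ^ e.2 := by
    intro w r
    rw [mul_assoc, ← zpow_add₀ hα0, show -w.1 - e.2 + w.2 = (w.2 - w.1) - e.2 by ring,
      zpow_sub₀ hα0 _ e.2]; ring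
  have he : α ^ e.2 ≠ 0 := by positivity
  simp only [rotate] at h2 h3
  have := hE p hp v hv q hq (-e.2, e.1 - e.2) (r * α ^ (-p.1 - e.2)) (s * α ^ (-v.1 - e.2))
    (t * α ^ (-q.1 - e.2)) (key _ _ hr) (key _ _ hs) (key _ _ ht)
    (by rw [hw, hw, hw, ← add_div, ← add_div, h3, div_self he])
    (by rw [hw1, hw1, hw1, ← add_div, ← add_div, h1, zpow_neg, one_div])
    (by rw [hw2, hw2, hw2, ← add_div, ← add_div, h2, zpow_sub₀ hα0])
  have hr : ∀ w : ℤ × ℤ, (-e.2, e.1 - e.2) = w → e = rotate w := by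
    rintro w rfl
    simp [rotate]
  exact this.imp (hr p) (Or.imp (hr v) (hr q))

/-! ### Local obstructions in columns and rows -/

/-- A lattice point in the column of a vertex `v`, between `v` and the segment `pq`. -/
theorem column (hα : 1 < α) (hE : IsEmptyConfig α Q) {p v q : ℤ × ℤ} (hp : p ∈ Q) (hv : v ∈ Q)
    (hq : q ∈ Q) (hpv : p.1 ≤ v.1) (hvq : v.1 ≤ q.1) (hpq : p.1 < q.1) (b : ℤ)
    (hb : (α ^ p.2 * (α ^ q.1 - α ^ v.1) + α ^ q.2 * (α ^ v.1 - α ^ p.1)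
        ≤ α ^ b * (α ^ q.1 - α ^ p.1) ∧ b ≤ v.2) ∨
      (α ^ b * (α ^ q.1 - α ^ p.1)
        ≤ α ^ p.2 * (α ^ q.1 - α ^ v.1) + α ^ q.2 * (α ^ v.1 - α ^ p.1) ∧ v.2 ≤ b)) :
    (v.1, b) = p ∨ (v.1, b) = v ∨ (v.1, b) = q := by
  have hd : 0 < α ^ q.1 - α ^ p.1 := sub_pos.mpr (zpow_lt_zpow_right₀ hα hpq)
  have h1 : 0 ≤ α ^ q.1 - α ^ v.1 := sub_nonneg.mpr (zpow_le_zpow_right₀ hα.le hvq)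
  have h2 : 0 ≤ α ^ v.1 - α ^ p.1 := sub_nonneg.mpr (zpow_le_zpow_right₀ hα.le hpv)
  set τ : ℝ := (α ^ v.1 - α ^ p.1) / (α ^ q.1 - α ^ p.1) with hτ
  have hτ0 : 0 ≤ τ := by positivity
  have hτ1 : 1 - τ = (α ^ q.1 - α ^ v.1) / (α ^ q.1 - α ^ p.1) := by
    rw [hτ]; field_simp; ring
  have hτ1' : 0 ≤ 1 - τ := by rw [hτ1]; positivity
  -- `H` is the height at which the segment `pq` crosses the column of `v`.
  set H : ℝ := (1 - τ) * α ^ p.2 + τ * α ^ q.2 with hH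
  have hHd : H * (α ^ q.1 - α ^ p.1) =
      α ^ p.2 * (α ^ q.1 - α ^ v.1) + α ^ q.2 * (α ^ v.1 - α ^ p.1) := by
    rw [hH, hτ1, hτ]; field_simp
  have hx : (1 - τ) * α ^ p.1 + τ * α ^ q.1 = α ^ v.1 := by
    rw [hτ1, hτ]; field_simp; ring
  obtain ⟨μ, hμ0, hμ1, hμ⟩ : ∃ μ : ℝ, 0 ≤ μ ∧ μ ≤ 1 ∧ (1 - μ) * H + μ * α ^ v.2 = α ^ b := by
    have hmem : α ^ b ∈ segment ℝ H (α ^ v.2) := by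
      rcases hb with ⟨hb, hbv⟩ | ⟨hb, hbv⟩
      · have h3 : H ≤ α ^ b := le_of_mul_le_mul_right (hHd ▸ hb) hd
        have h4 : α ^ b ≤ α ^ v.2 := zpow_le_zpow_right₀ hα.le hbv
        rw [segment_eq_Icc (h3.trans h4)]
        exact ⟨h3, h4⟩
      · have h3 : α ^ b ≤ H := le_of_mul_le_mul_right (hHd ▸ hb) hd
        have h4 : α ^ v.2 ≤ α ^ b := zpow_le_zpow_right₀ hα.le hbv
        rw [segment_symm, segment_eq_Icc (h4.trans h3)]
        exact ⟨h4, h3⟩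
    obtain ⟨x, y, hx, hy, hxy, h⟩ := hmem
    exact ⟨y, hy, by linarith, by rw [← h, ← hxy]; simp⟩
  refine hE p hp v hv q hq (v.1, b) ((1 - μ) * (1 - τ)) μ ((1 - μ) * τ)
    (mul_nonneg (by linarith) hτ1') hμ0 (mul_nonneg (by linarith) hτ0) (by ring) ?_ ?_
  · linear_combination (1 - μ) * hx
  · linear_combination hμ

/-- A lattice point in the row of a vertex `v`, between `v` and the segment `pq`. -/
theorem row (hα : 1 < α) (hE : IsEmptyConfig α Q) {p v q : ℤ × ℤ} (hp : p ∈ Q) (hv : v ∈ Q)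
    (hq : q ∈ Q) (hpv : p.2 ≤ v.2) (hvq : v.2 ≤ q.2) (hpq : p.2 < q.2) (a : ℤ)
    (ha : (α ^ p.1 * (α ^ q.2 - α ^ v.2) + α ^ q.1 * (α ^ v.2 - α ^ p.2)
        ≤ α ^ a * (α ^ q.2 - α ^ p.2) ∧ a ≤ v.1) ∨
      (α ^ a * (α ^ q.2 - α ^ p.2)
        ≤ α ^ p.1 * (α ^ q.2 - α ^ v.2) + α ^ q.1 * (α ^ v.2 - α ^ p.2) ∧ v.1 ≤ a)) :
    (a, v.2) = p ∨ (a, v.2) = v ∨ (a, v.2) = q := by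
  have := hE.swap.column hα (Finset.mem_image_of_mem _ hp) (Finset.mem_image_of_mem _ hv)
    (Finset.mem_image_of_mem _ hq) hpv hvq hpq a ha
  have hs : ∀ w : ℤ × ℤ, (v.swap.1, a) = w.swap → (a, v.2) = w := fun w h =>
    Prod.swap_injective h
  exact this.imp (hs p) (Or.imp (hs v) (hs q))

/-- No vertex lies strictly below or strictly above two vertices on both sides of its column. -/
theorem not_between (hα : 1 < α) (hE : IsEmptyConfig α Q) {p v q : ℤ × ℤ} (hp : p ∈ Q)
    (hv : v ∈ Q) (hq : q ∈ Q) (hpv : p.1 < v.1) (hvq : v.1 < q.1)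
    (h : (p.2 < v.2 ∧ q.2 < v.2) ∨ (v.2 < p.2 ∧ v.2 < q.2)) : False := by
  have h1 : 0 < α ^ q.1 - α ^ v.1 := sub_pos.mpr (zpow_lt_zpow_right₀ hα hvq)
  have h2 : 0 < α ^ v.1 - α ^ p.1 := sub_pos.mpr (zpow_lt_zpow_right₀ hα hpv)
  -- The lattice point one step from `v` towards `p` and `q` does not pass the segment `pq`.
  have key : ∃ b : ℤ, b ≠ v.2 ∧ ((α ^ p.2 * (α ^ q.1 - α ^ v.1) + α ^ q.2 * (α ^ v.1 - α ^ p.1)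
        ≤ α ^ b * (α ^ q.1 - α ^ p.1) ∧ b ≤ v.2) ∨
      (α ^ b * (α ^ q.1 - α ^ p.1)
        ≤ α ^ p.2 * (α ^ q.1 - α ^ v.1) + α ^ q.2 * (α ^ v.1 - α ^ p.1) ∧ v.2 ≤ b)) := by
    rcases h with ⟨hp2, hq2⟩ | ⟨hp2, hq2⟩
    · refine ⟨v.2 - 1, by omega, Or.inl ⟨?_, by omega⟩⟩
      have h3 : α ^ p.2 ≤ α ^ (v.2 - 1) := zpow_le_zpow_right₀ hα.le (by omega)
      have h4 : α ^ q.2 ≤ α ^ (v.2 - 1) := zpow_le_zpow_right₀ hα.le (by omega)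
      linarith [mul_le_mul_of_nonneg_right h3 h1.le, mul_le_mul_of_nonneg_right h4 h2.le]
    · refine ⟨v.2 + 1, by omega, Or.inr ⟨?_, by omega⟩⟩
      have h3 : α ^ (v.2 + 1) ≤ α ^ p.2 := zpow_le_zpow_right₀ hα.le (by omega)
      have h4 : α ^ (v.2 + 1) ≤ α ^ q.2 := zpow_le_zpow_right₀ hα.le (by omega)
      linarith [mul_le_mul_of_nonneg_right h3 h1.le, mul_le_mul_of_nonneg_right h4 h2.le]
  obtain ⟨b, hb, hb'⟩ := key
  rcases hE.column hα hp hv hq hpv.le hvq.le (hpv.trans hvq) b hb' with h | h | h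
  · rw [← h] at hpv; exact lt_irrefl _ hpv
  · rw [← h] at hb; exact hb rfl
  · rw [← h] at hvq; exact lt_irrefl _ hvq

theorem not_between_swap (hα : 1 < α) (hE : IsEmptyConfig α Q) {p v q : ℤ × ℤ} (hp : p ∈ Q)
    (hv : v ∈ Q) (hq : q ∈ Q) (hpv : p.2 < v.2) (hvq : v.2 < q.2)
    (h : (p.1 < v.1 ∧ q.1 < v.1) ∨ (v.1 < p.1 ∧ v.1 < q.1)) : False :=
  hE.swap.not_between hα (Finset.mem_image_of_mem _ hp) (Finset.mem_image_of_mem _ hv)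
    (Finset.mem_image_of_mem _ hq) hpv hvq h

/-- Two vertices in a common row are neighbours. -/
theorem row_adjacent (hα : 1 < α) (hE : IsEmptyConfig α Q) {p q : ℤ × ℤ} (hp : p ∈ Q)
    (hq : q ∈ Q) (h : p.2 = q.2) : q.1 ≤ p.1 + 1 := by
  by_contra hlt
  have h1 : α ^ p.1 < α ^ (p.1 + 1) := zpow_lt_zpow_right₀ hα (by omega)
  have h2 : α ^ (p.1 + 1) < α ^ q.1 := zpow_lt_zpow_right₀ hα (by omega)
  obtain ⟨x, y, hx, hy, hxy, hs⟩ : α ^ (p.1 + 1) ∈ segment ℝ (α ^ p.1) (α ^ q.1) := by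
    rw [segment_eq_Icc (h1.trans h2).le]
    exact ⟨h1.le, h2.le⟩
  simp only [smul_eq_mul] at hs
  have := hE p hp p hp q hq (p.1 + 1, p.2) x 0 y hx le_rfl hy (by linarith)
    (by simpa using hs) (by rw [← h]; linear_combination α ^ p.2 * hxy)
  rcases this with e | e | e <;> · rw [Prod.ext_iff] at e; simp only at e; omega

/-! ### Strictly decreasing pairs force monotonicity -/

/-- Vertices of a strictly decreasing pair are strictly comparable to no vertex. -/
theorem not_comparable (hα : 1 < α) (hE : IsEmptyConfig α Q) {u v z : ℤ × ℤ} (hu : u ∈ Q)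
    (hv : v ∈ Q) (hz : z ∈ Q) (h : (u.1 < v.1 ∧ v.2 < u.2) ∨ (v.1 < u.1 ∧ u.2 < v.2)) :
    ¬ ((u.1 < z.1 ∧ u.2 < z.2) ∨ (z.1 < u.1 ∧ z.2 < u.2)) := by
  rintro (⟨h1, h2⟩ | ⟨h1, h2⟩) <;> rcases h with ⟨h3, h4⟩ | ⟨h3, h4⟩
  · exact hE.not_between_swap hα hv hu hz h4 h2 (Or.inr ⟨h3, h1⟩)
  · exact hE.not_between hα hv hu hz h3 h1 (Or.inr ⟨h4, h2⟩)
  · exact hE.not_between hα hz hu hv h1 h3 (Or.inl ⟨h2, h4⟩)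
  · exact hE.not_between_swap hα hz hu hv h2 h4 (Or.inl ⟨h1, h3⟩)

/-- A configuration with a strictly decreasing pair is weakly decreasing, or has at most four
points. -/
theorem antitone_of_decreasing_pair (hα : 1 < α) (hE : IsEmptyConfig α Q) {u v : ℤ × ℤ}
    (hu : u ∈ Q) (hv : v ∈ Q) (huv : u.1 < v.1) (hvu : v.2 < u.2) (hQ : 5 ≤ Q.card) :
    ∀ z ∈ Q, ∀ z' ∈ Q, z.1 < z'.1 → z'.2 ≤ z.2 := by
  by_contra hcon
  push Not at hcon
  obtain ⟨z, hz, z', hz', h1, h2⟩ := hcon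
  -- Each of `u`, `v` shares a coordinate with each of `z`, `z'`, so the four are the corners of an
  -- axis-parallel rectangle. Any further `y` is tied in the same way to one of the two diagonals
  -- and is therefore a corner.
  have hsub : Q ⊆ {u, v, z, z'} := by
    intro y hy
    have tie : ∀ a b : ℤ × ℤ, ¬ ((a.1 < b.1 ∧ b.2 < a.2) ∨ (b.1 < a.1 ∧ a.2 < b.2)) →
        ¬ ((a.1 < b.1 ∧ a.2 < b.2) ∨ (b.1 < a.1 ∧ b.2 < a.2)) → a.1 = b.1 ∨ a.2 = b.2 := by
      intro a b; omega
    have cu := fun w hw => hE.not_comparable hα (z := w) hu hv hw (Or.inl ⟨huv, hvu⟩)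
    have cv := fun w hw => hE.not_comparable hα (z := w) hv hu hw (Or.inr ⟨huv, hvu⟩)
    have dz := fun w hw hD => hE.not_comparable hα (u := z) (v := w) hz hw hz' hD
      (Or.inl ⟨h1, h2⟩)
    have dz' := fun w hw hD => hE.not_comparable hα (u := z') (v := w) hz' hw hz hD
      (Or.inr ⟨h1, h2⟩)
    have tzu := tie u z (fun h => dz u hu h.symm) (cu z hz)
    have tzv := tie v z (fun h => dz v hv h.symm) (cv z hz)
    have tzu' := tie u z' (fun h => dz' u hu h.symm) (cu z' hz')
    have tzv' := tie v z' (fun h => dz' v hv h.symm) (cv z' hz')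
    have e1 : z.1 = u.1 ∧ z.2 = v.2 := by clear cu cv dz dz' tie; omega
    have e2 : z'.1 = v.1 ∧ z'.2 = u.2 := by clear cu cv dz dz' tie; omega
    have hDy : ∀ w ∈ Q, ((y.1 < w.1 ∧ w.2 < y.2) ∨ (w.1 < y.1 ∧ y.2 < w.2)) →
        y = u ∨ y = v := by
      intro w hw hD
      have t := tie y z (fun h => dz y hy h.symm) (hE.not_comparable hα hy hw hz hD)
      have t' := tie y z' (fun h => dz' y hy h.symm)
        (hE.not_comparable hα hy hw hz' hD)
      simp only [Prod.ext_iff]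
      clear cu cv dz dz' tie tzu tzv tzu' tzv' hD
      omega
    simp only [Finset.mem_insert, Finset.mem_singleton]
    by_cases hyu : (y.1 < u.1 ∧ u.2 < y.2) ∨ (u.1 < y.1 ∧ y.2 < u.2)
    · exact (hDy u hu hyu).imp_right Or.inl
    by_cases hyv : (y.1 < v.1 ∧ v.2 < y.2) ∨ (v.1 < y.1 ∧ y.2 < v.2)
    · exact (hDy v hv hyv).imp_right Or.inl
    have t := tie u y (fun h => hyu h.symm) (cu y hy)
    have t' := tie v y (fun h => hyv h.symm) (cv y hy)
    right; right
    simp only [Prod.ext_iff]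
    clear cu cv dz dz' tie tzu tzv tzu' tzv' hDy hyu hyv
    omega
  have := Finset.card_le_card hsub
  have h4 : ({u, v, z, z'} : Finset (ℤ × ℤ)).card ≤ 4 := Finset.card_le_four
  omega


/-! ### Counting a weakly decreasing configuration -/

/-- A weakly decreasing configuration has at most `2 * k + 3` points. -/
theorem card_le_of_antitone (hα : 1 < α) (hE : IsEmptyConfig α Q) {k : ℕ} (hk : 1 ≤ k)
    (hαk : α ^ (-(k : ℤ)) ≤ 1 - α ^ (-1 : ℤ))
    (hanti : ∀ z ∈ Q, ∀ z' ∈ Q, z.1 < z'.1 → z'.2 ≤ z.2) : Q.card ≤ 2 * k + 3 := by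
  have hα0 : 0 < α := by linarith
  rcases Q.eq_empty_or_nonempty with rfl | hne
  · simp
  -- Extremes of `z.2 - z.1` pick out the top-left point `p` and the bottom-right point `q`.
  obtain ⟨p, hp, hpmax⟩ := Q.exists_max_image (fun z => z.2 - z.1) hne
  obtain ⟨q, hq, hqmin⟩ := Q.exists_min_image (fun z => z.2 - z.1) hne
  have hpz : ∀ z ∈ Q, p.1 ≤ z.1 ∧ z.2 ≤ p.2 := by
    intro z hz
    have h1 := hpmax z hz
    have h2 := hanti z hz p hp
    have h3 := hanti p hp z hz
    omega
  have hqz : ∀ z ∈ Q, z.1 ≤ q.1 ∧ q.2 ≤ z.2 := by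
    intro z hz
    have h1 := hqmin z hz
    have h2 := hanti z hz q hq
    have h3 := hanti q hq z hz
    omega
  by_cases hpq1 : q.1 ≤ p.1
  · have : Q.card ≤ (Finset.Icc (p.2 - 1) p.2).card := by
      have he : ∀ z ∈ Q, z.1 = p.1 := fun z hz => by
        have h1 := hpz z hz
        have h2 := hqz z hz
        omega
      refine Finset.card_le_card_of_injOn Prod.snd (fun z hz => ?_) fun z hz z' hz' h =>
        Prod.ext ((he z hz).trans (he z' hz').symm) h
      have h1 := hpz z hz
      have h2 := hE.swap.row_adjacent hα (Finset.mem_image_of_mem _ hz)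
        (Finset.mem_image_of_mem _ hp) (he z hz)
      simp only [Prod.fst_swap] at h2
      simp only [Finset.coe_Icc, Set.mem_Icc]
      omega
    simp only [Int.card_Icc] at this
    omega
  by_cases hpq2 : p.2 ≤ q.2
  · have : Q.card ≤ (Finset.Icc p.1 (p.1 + 1)).card := by
      have he : ∀ z ∈ Q, z.2 = p.2 := fun z hz => by
        have h1 := hpz z hz
        have h2 := hqz z hz
        omega
      refine Finset.card_le_card_of_injOn Prod.fst (fun z hz => ?_) fun z hz z' hz' h =>
        Prod.ext h ((he z hz).trans (he z' hz').symm)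
      have h1 := hpz z hz
      have h2 := hE.row_adjacent hα hp hz (he z hz).symm
      simp only [Finset.coe_Icc, Set.mem_Icc]
      omega
    simp only [Int.card_Icc] at this
    omega
  push Not at hpq1 hpq2
  have hx : 0 < α ^ q.1 - α ^ p.1 := sub_pos.mpr (zpow_lt_zpow_right₀ hα hpq1)
  -- `A z` says that `z` lies on or above the line `pq`
  let A : ℤ × ℤ → Prop := fun z =>
    α ^ p.2 * (α ^ q.1 - α ^ z.1) + α ^ q.2 * (α ^ z.1 - α ^ p.1) ≤ α ^ z.2 * (α ^ q.1 - α ^ p.1)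
  classical
  set R := (Q.erase p).erase q with hR
  have hRQ : ∀ z ∈ R, z ∈ Q ∧ z ≠ p ∧ z ≠ q := fun z hz => by
    simp only [hR, Finset.mem_erase] at hz
    tauto
  have hgap : ∀ a b : ℤ, a < b → α ^ b * α ^ (-(k : ℤ)) ≤ α ^ b - α ^ a := by
    intro a b hab
    have h1 : α ^ a ≤ α ^ (b - 1) := zpow_le_zpow_right₀ hα.le (by omega)
    have h2 : α ^ (b - 1) = α ^ b * α ^ (-1 : ℤ) := by rw [← zpow_add₀ hα0.ne']; rfl
    have h3 := mul_le_mul_of_nonneg_left hαk (zpow_pos hα0 b).le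
    linarith
  have hU : (R.filter fun z => A z).card ≤ k + 1 := by
    have hsub : ((R.filter fun z => A z).filter fun z => z.2 ≠ p.2).card ≤ k := by
      have : ((R.filter fun z => A z).filter fun z => z.2 ≠ p.2).card ≤
          (Finset.Ioc (q.1 - k) q.1).card := by
        refine Finset.card_le_card_of_injOn Prod.fst ?_ ?_
        · intro z hz
          simp only [Finset.coe_filter, Finset.mem_filter, Set.mem_ofPred_eq] at hz
          obtain ⟨⟨hz, hA⟩, hzp⟩ := hz
          have hzQ := (hRQ z hz).1
          have h1 := (hpz z hzQ)
          have h2 := (hqz z hzQ)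
          rw [Finset.coe_Ioc, Set.mem_Ioc]
          refine ⟨?_, h2.1⟩
          have h3 := hgap z.2 p.2 (by omega)
          -- Being below the top row costs at least the fraction `α ^ (-k)` of `α ^ p.2` in height;
          -- a point on or above `pq` must then be at least that fraction of the way across from `p`
          -- to `q`.
          have h4 : α ^ p.2 * (α ^ (-(k : ℤ)) * (α ^ q.1 - α ^ p.1)) ≤
              α ^ p.2 * (α ^ z.1 - α ^ p.1) := by
            have h5 := mul_le_mul_of_nonneg_right h3 hx.le
            have h6 : 0 ≤ α ^ q.2 * (α ^ z.1 - α ^ p.1) := mul_nonneg (by positivity)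
              (sub_nonneg.mpr (zpow_le_zpow_right₀ hα.le h1.1))
            simp only [A] at hA
            linarith
          have h5 := le_of_mul_le_mul_left h4 (by positivity)
          have h6 : α ^ (-(k : ℤ)) * α ^ p.1 < α ^ p.1 := by
            rw [← zpow_add₀ hα0.ne']
            exact zpow_lt_zpow_right₀ hα (by omega)
          have h7 : α ^ (q.1 - k) < α ^ z.1 := by
            rw [sub_eq_neg_add, zpow_add₀ hα0.ne']
            linarith
          exact (zpow_lt_zpow_iff_right₀ hα).mp h7
        -- Of two points in one column on the same side of `pq`, the nearer lies in the triangle of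
        -- the farther with `p` and `q`.
        · have key : ∀ z ∈ R, ∀ z' ∈ R, A z' → z.1 = z'.1 → z.2 ≤ z'.2 := by
            intro z hz z' hz' hA he
            by_contra! hlt
            have e' : (z.1, z'.2) = z' := Prod.ext he rfl
            obtain ⟨hzQ, -, -⟩ := hRQ z hz
            obtain ⟨hzQ', hzp', hzq'⟩ := hRQ z' hz'
            have := hE.column hα hp hzQ hq (hpz z hzQ).1 (hqz z hzQ).1 hpq1 z'.2
              (Or.inl ⟨by simpa only [A, he] using hA, hlt.le⟩)
            rw [e'] at this
            rcases this with e | e | e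
            · exact hzp' e
            · rw [e] at hlt; exact lt_irrefl _ hlt
            · exact hzq' e
          intro z hz z' hz' he
          simp only [Finset.coe_filter, Finset.mem_filter, Set.mem_ofPred_eq] at hz hz'
          exact Prod.ext he (le_antisymm (key z hz.1.1 z' hz'.1.1 hz'.1.2 he)
            (key z' hz'.1.1 z hz.1.1 hz.1.2 he.symm))
      simpa using this
    have htop : ((R.filter fun z => A z).filter fun z => ¬ z.2 ≠ p.2).card ≤ 1 := by
      rw [Finset.card_le_one]
      have key : ∀ z ∈ R, z.2 = p.2 → z.1 = p.1 + 1 := by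
        intro z hz hzp
        have hzQ := hRQ z hz
        have h1 := hE.row_adjacent hα hp hzQ.1 hzp.symm
        have h2 := hpz z hzQ.1
        have h3 : z.1 ≠ p.1 := fun h => hzQ.2.1 (Prod.ext h hzp)
        omega
      intro z hz z' hz'
      simp only [Finset.mem_filter, not_not] at hz hz'
      exact Prod.ext ((key z hz.1.1 hz.2).trans (key z' hz'.1.1 hz'.2).symm)
        (hz.2.trans hz'.2.symm)
    have := Finset.card_filter_add_card_filter_not (s := R.filter fun z => A z)
      (fun z => z.2 ≠ p.2)
    omega
  have hW : (R.filter fun z => ¬ A z).card ≤ k := by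
    have : (R.filter fun z => ¬ A z).card ≤ (Finset.Ico (q.1 - k) q.1).card := by
      refine Finset.card_le_card_of_injOn Prod.fst ?_ ?_
      · intro z hz
        simp only [Finset.coe_filter, Set.mem_ofPred_eq, A, not_le] at hz
        obtain ⟨hz, hA⟩ := hz
        obtain ⟨hzQ, hzp, hzq⟩ := hRQ z hz
        have h1 := (hpz z hzQ)
        have h2 := (hqz z hzQ)
        have hx1 : 0 ≤ α ^ z.1 - α ^ p.1 := sub_nonneg.mpr (zpow_le_zpow_right₀ hα.le h1.1)
        have hx2 : 0 ≤ α ^ q.1 - α ^ z.1 := sub_nonneg.mpr (zpow_le_zpow_right₀ hα.le h2.1)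
        have hz1 : z.1 ≠ q.1 := by
          intro h
          have h3 : α ^ q.2 ≤ α ^ z.2 := zpow_le_zpow_right₀ hα.le h2.2
          rw [h, sub_self, mul_zero, zero_add] at hA
          exact absurd (lt_of_mul_lt_mul_right hA hx.le) (not_lt.mpr h3)
        have hz2 : z.2 ≠ p.2 := by
          intro h
          have h3 : α ^ q.2 ≤ α ^ p.2 := zpow_le_zpow_right₀ hα.le hpq2.le
          rw [h] at hA
          have := mul_le_mul_of_nonneg_right h3 hx1
          linarith
        rw [Finset.coe_Ico, Set.mem_Ico]
        refine ⟨?_, lt_of_le_of_ne h2.1 hz1⟩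
        -- If `z.1 + 1 ≤ q.1 - k`, the right-hand neighbour of `z` still does not pass the line
        -- `pq`, so it is a forbidden point of the triangle.
        by_contra hlt
        push Not at hlt
        have hzp2 : z.2 < p.2 := lt_of_le_of_ne h1.2 hz2
        have h3 := hgap z.2 p.2 hzp2
        have h4 : α ^ (z.1 + 1) ≤ α ^ q.1 * α ^ (-(k : ℤ)) := by
          rw [← zpow_add₀ hα0.ne']
          exact zpow_le_zpow_right₀ hα.le (by omega)
        have h5 := mul_le_mul_of_nonneg_left h3 (zpow_pos hα0 q.1).le
        have h6 := mul_le_mul_of_nonneg_right h4 (zpow_pos hα0 p.2).le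
        have h7 : 0 ≤ α ^ p.1 * (α ^ z.2 - α ^ q.2) := mul_nonneg (by positivity)
          (sub_nonneg.mpr (zpow_le_zpow_right₀ hα.le h2.2))
        have h8 : 0 ≤ α ^ (z.1 + 1) * α ^ q.2 := by positivity
        rcases hE.row hα hq hzQ hp h2.2 h1.2 hpq2 (z.1 + 1) (Or.inr ⟨by linarith, by omega⟩)
          with e | e | e <;> · rw [Prod.ext_iff] at e; simp only at e; omega
      · have key : ∀ z ∈ R, ∀ z' ∈ R, ¬ A z' → z.1 = z'.1 → z'.2 ≤ z.2 := by
          intro z hz z' hz' hA he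
          by_contra! hlt
          have e' : (z.1, z'.2) = z' := Prod.ext he rfl
          obtain ⟨hzQ, -, -⟩ := hRQ z hz
          obtain ⟨hzQ', hzp', hzq'⟩ := hRQ z' hz'
          have := hE.column hα hp hzQ hq (hpz z hzQ).1 (hqz z hzQ).1 hpq1 z'.2
            (Or.inr ⟨by simpa only [A, he, not_le] using (not_le.mp hA).le, hlt.le⟩)
          rw [e'] at this
          rcases this with e | e | e
          · exact hzp' e
          · rw [e] at hlt; exact lt_irrefl _ hlt
          · exact hzq' e
        intro z hz z' hz' he
        simp only [Finset.coe_filter, Set.mem_ofPred_eq] at hz hz'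
        exact Prod.ext he (le_antisymm (key z' hz'.1 z hz.1 hz.2 he.symm)
          (key z hz.1 z' hz'.1 hz'.2 he))
    simpa using this
  have h1 : (R.filter fun z => A z).card + (R.filter fun z => ¬ A z).card = R.card :=
    Finset.card_filter_add_card_filter_not A
  have h2 := Finset.card_erase_add_one hp
  have h3 := Finset.card_erase_add_one (Finset.mem_erase.mpr
    ⟨fun e : q = p => absurd (congrArg Prod.fst e) hpq1.ne', hq⟩)
  rw [← hR] at h3
  omega


/-! ### The bound for arbitrary empty configurations -/

/-- The points of a configuration sharing the row of `u`. -/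
theorem card_row_le (hα : 1 < α) (hE : IsEmptyConfig α Q) {u : ℤ × ℤ} (hu : u ∈ Q) :
    ((Q.erase u).filter fun z => z.2 = u.2).card ≤ 1 := by
  rw [Finset.card_le_one]
  intro z hz z' hz'
  simp only [Finset.mem_filter, Finset.mem_erase, ne_eq, Prod.ext_iff] at hz hz' ⊢
  have h1 := hE.row_adjacent hα hu hz.1.2 hz.2.symm
  have h2 := hE.row_adjacent hα hz.1.2 hu hz.2
  have h3 := hE.row_adjacent hα hu hz'.1.2 hz'.2.symm
  have h4 := hE.row_adjacent hα hz'.1.2 hu hz'.2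
  have h5 := hE.row_adjacent hα hz.1.2 hz'.1.2 (hz.2.trans hz'.2.symm)
  have h6 := hE.row_adjacent hα hz'.1.2 hz.1.2 (hz'.2.trans hz.2.symm)
  omega

theorem card_image_row_le (hα : 1 < α) {f : ℤ × ℤ → ℤ × ℤ} (hf : Function.Injective f)
    (hE : IsEmptyConfig α (Q.image f)) {u : ℤ × ℤ} (hu : u ∈ Q) :
    ((Q.erase u).filter fun z => (f z).2 = (f u).2).card ≤ 1 := by
  have := hE.card_row_le hα (Finset.mem_image_of_mem f hu)
  rw [← Finset.image_erase hf, Finset.filter_image, Finset.card_image_of_injective _ hf] at this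
  exact this

theorem card_le (hα : 1 < α) (hE : IsEmptyConfig α Q) {k : ℕ} (hk : 1 ≤ k)
    (hαk : α ^ (-(k : ℤ)) ≤ 1 - α ^ (-1 : ℤ)) : Q.card ≤ 2 * k + 3 := by
  have step : ∀ Q' : Finset (ℤ × ℤ), Q'.card = Q.card → IsEmptyConfig α Q' →
      (∃ u ∈ Q', ∃ v ∈ Q', u.1 < v.1 ∧ v.2 < u.2) → Q.card ≤ 2 * k + 3 := by
    rintro Q' hc hE' ⟨u, hu, v, hv, h1, h2⟩
    by_cases h5 : 5 ≤ Q'.card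
    · exact hc ▸ hE'.card_le_of_antitone hα hk hαk
        (hE'.antitone_of_decreasing_pair hα hu hv h1 h2 h5)
    · omega
  have hE1 := hE.image_rotate hα
  have hE2 := hE1.image_rotate hα
  have hc1 := Finset.card_image_of_injective Q rotate_injective
  have hc2 := Finset.card_image_of_injective (Q.image rotate) rotate_injective
  by_cases hd : ∃ u ∈ Q, ∃ v ∈ Q, u.1 < v.1 ∧ v.2 < u.2
  · exact step Q rfl hE hd
  by_cases hd1 : ∃ u ∈ Q, ∃ v ∈ Q, (rotate u).1 < (rotate v).1 ∧ (rotate v).2 < (rotate u).2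
  · obtain ⟨u, hu, v, hv, h⟩ := hd1
    exact step _ hc1 hE1
      ⟨_, Finset.mem_image_of_mem _ hu, _, Finset.mem_image_of_mem _ hv, h⟩
  by_cases hd2 : ∃ u ∈ Q, ∃ v ∈ Q, (rotate (rotate u)).1 < (rotate (rotate v)).1 ∧
      (rotate (rotate v)).2 < (rotate (rotate u)).2
  · obtain ⟨u, hu, v, hv, h⟩ := hd2
    exact step _ (hc2.trans hc1) hE2
      ⟨_, Finset.mem_image_of_mem _ (Finset.mem_image_of_mem _ hu), _,
        Finset.mem_image_of_mem _ (Finset.mem_image_of_mem _ hv), h⟩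
  push Not at hd hd1 hd2
  rcases Q.eq_empty_or_nonempty with rfl | ⟨u, hu⟩
  · simp
  have r0 := hE.card_row_le hα hu
  have r1 := card_image_row_le hα rotate_injective hE1 hu
  rw [Finset.image_image] at hE2
  have r2 := card_image_row_le hα (rotate_injective.comp rotate_injective) hE2 hu
  -- With `z - u = (x, y)`, the absence of decreasing pairs in the three charts gives `x * y ≥ 0`,
  -- `x * (x - y) ≥ 0` and `y * (y - x) ≥ 0`. Hence `y = 0`, `x = 0` or `x = y`, which is a common
  -- row in the respective chart.
  have hsub : Q.erase u ⊆ ((Q.erase u).filter fun z => z.2 = u.2) ∪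
      (((Q.erase u).filter fun z => (rotate z).2 = (rotate u).2) ∪
        ((Q.erase u).filter fun z => ((rotate ∘ rotate) z).2 = ((rotate ∘ rotate) u).2)) := by
    intro z hz
    have hzQ := Finset.mem_of_mem_erase hz
    have a1 := hd z hzQ u hu
    have a2 := hd u hu z hzQ
    have b1 := hd1 z hzQ u hu
    have b2 := hd1 u hu z hzQ
    have c1 := hd2 z hzQ u hu
    have c2 := hd2 u hu z hzQ
    simp only [Finset.mem_union, Finset.mem_filter, hz, true_and]
    simp only [rotate, Function.comp] at b1 b2 c1 c2 ⊢
    clear hd hd1 hd2 step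
    omega
  have h1 := Finset.card_le_card hsub
  have h2 := Finset.card_union_le ((Q.erase u).filter fun z => z.2 = u.2)
    (((Q.erase u).filter fun z => (rotate z).2 = (rotate u).2) ∪
        ((Q.erase u).filter fun z => ((rotate ∘ rotate) z).2 = ((rotate ∘ rotate) u).2))
  have h3 := Finset.card_union_le ((Q.erase u).filter fun z => (rotate z).2 = (rotate u).2)
        ((Q.erase u).filter fun z => ((rotate ∘ rotate) z).2 = ((rotate ∘ rotate) u).2)
  have h4 := Finset.card_erase_add_one hu
  omega

end IsEmptyConfig

/-! ### From the lattice to exponents, and the theorem -/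

/-- The exponential lattice meets bounded sets in finite sets. -/
theorem finite_expLattice_inter_convexHull {d : ℕ} {α : ℝ} (hα : 1 < α) {T : Set (Fin d → ℝ)}
    (hT : T.Finite) : (expLattice d α ∩ convexHull ℝ T).Finite := by
  obtain ⟨M, hM⟩ := (isBounded_convexHull.mpr hT.isBounded).exists_norm_le
  obtain ⟨N, hN⟩ := pow_unbounded_of_one_lt M hα
  have hfin : {x : Fin d → ℝ | ∀ i, x i ∈ (fun n : ℕ => α ^ n) '' Set.Iio N}.Finite :=
    Set.Finite.pi' fun _ => (Set.finite_Iio N).image _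
  refine hfin.subset fun x hx i => ?_
  obtain ⟨n, hn⟩ := hx.1 i
  refine ⟨n, ?_, hn.symm⟩
  have h1 : α ^ n ≤ M := by
    rw [← hn]
    exact (le_abs_self _).trans ((norm_le_pi_norm x i).trans (hM x hx.2))
  exact (pow_lt_pow_iff_right₀ hα).mp (h1.trans_lt hN)

/-- The point of the plane with exponents `z`. -/
noncomputable def expPoint (α : ℝ) (z : ℤ × ℤ) : Fin 2 → ℝ := ![α ^ z.1, α ^ z.2]

theorem expPoint_injective {α : ℝ} (hα : 1 < α) : Function.Injective (expPoint α) := by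
  intro z w h
  have h0 := congrFun h 0
  have h1 := congrFun h 1
  simp only [expPoint, Matrix.cons_val_zero, Matrix.cons_val_one] at h0 h1
  exact Prod.ext (zpow_right_injective₀ (by linarith) hα.ne' h0)
    (zpow_right_injective₀ (by linarith) hα.ne' h1)

theorem exists_eq_pow_of_one_le {α : ℝ} (hα : 1 < α) {a : ℤ} (h : 1 ≤ α ^ a) :
    ∃ n : ℕ, α ^ a = α ^ n := by
  have : 0 ≤ a := (one_le_zpow_iff_right₀ hα).mp h
  lift a to ℕ using this
  exact ⟨a, zpow_natCast α a⟩

/-- A finite subset of the exponential lattice whose subsets have hulls without further lattice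
points gives an empty configuration of exponents. -/
theorem exists_isEmptyConfig {α : ℝ} (hα : 1 < α) (Q : Finset (Fin 2 → ℝ))
    (hQ : (Q : Set (Fin 2 → ℝ)) ⊆ expLattice 2 α)
    (hempty : ∀ A ⊆ (Q : Set (Fin 2 → ℝ)), expLattice 2 α ∩ convexHull ℝ A ⊆ A) :
    ∃ Q' : Finset (ℤ × ℤ), Q'.card = Q.card ∧ IsEmptyConfig α Q' := by
  classical
  have hinj := expPoint_injective hα
  refine ⟨Q.preimage (expPoint α) hinj.injOn, ?_, ?_⟩
  · rw [Finset.card_preimage]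
    congr 1
    rw [Finset.filter_eq_self]
    intro x hx
    obtain ⟨m, hm⟩ := hQ hx 0
    obtain ⟨n, hn⟩ := hQ hx 1
    refine ⟨(m, n), ?_⟩
    ext i
    fin_cases i <;> simp [expPoint, hm, hn]
  · intro p hp v hv q hq e r s t hr hs ht h1 h2 h3
    rw [Finset.mem_preimage] at hp hv hq
    have hge : ∀ z : ℤ × ℤ, expPoint α z ∈ Q → 1 ≤ α ^ z.1 ∧ 1 ≤ α ^ z.2 := by
      intro z hz
      obtain ⟨m, hm⟩ := hQ hz 0
      obtain ⟨n, hn⟩ := hQ hz 1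
      simp only [expPoint, Matrix.cons_val_zero, Matrix.cons_val_one] at hm hn
      rw [hm, hn]
      exact ⟨one_le_pow₀ hα.le, one_le_pow₀ hα.le⟩
    have hcomb : r • expPoint α p + s • expPoint α v + t • expPoint α q = expPoint α e := by
      ext i
      fin_cases i <;> simp [expPoint, h2, h3]
    have hmem : expPoint α e ∈ convexHull ℝ {expPoint α p, expPoint α v, expPoint α q} := by
      rw [← hcomb]
      have hc := convex_convexHull ℝ {expPoint α p, expPoint α v, expPoint α q}
      have hsub := subset_convexHull ℝ {expPoint α p, expPoint α v, expPoint α q}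
      have := hc.sum_mem (t := Finset.univ) (w := ![r, s, t])
        (z := ![expPoint α p, expPoint α v, expPoint α q])
        (by intro i _; fin_cases i <;> simpa) (by simpa [Fin.sum_univ_three] using h1)
        (by intro i _; fin_cases i <;> exact hsub (by simp))
      simpa [Fin.sum_univ_three] using this
    -- Convex combinations of coordinates at least `1` are at least `1`, so admitting integer
    -- exponents creates no new points in these triangles.
    have he : expPoint α e ∈ expLattice 2 α := by
      have hp' := hge p hp
      have hv' := hge v hv
      have hq' := hge q hq
      have b1 : 1 ≤ α ^ e.1 := by
        rw [← h2]
        linarith [mul_le_mul_of_nonneg_left hp'.1 hr, mul_le_mul_of_nonneg_left hv'.1 hs,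
          mul_le_mul_of_nonneg_left hq'.1 ht]
      have b2 : 1 ≤ α ^ e.2 := by
        rw [← h3]
        linarith [mul_le_mul_of_nonneg_left hp'.2 hr, mul_le_mul_of_nonneg_left hv'.2 hs,
          mul_le_mul_of_nonneg_left hq'.2 ht]
      intro i
      fin_cases i
      · exact exists_eq_pow_of_one_le hα b1
      · exact exists_eq_pow_of_one_le hα b2
    have := hempty {expPoint α p, expPoint α v, expPoint α q} (by
      rintro x (rfl | rfl | rfl) <;> assumption) ⟨he, hmem⟩
    exact this.imp (fun h => hinj h) (Or.imp (fun h => hinj h) (fun h => hinj h))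

theorem theorem1 (α : ℝ) (hα : 1 < α) :
    hellyNumber (expLattice 2 α) ≤ ((2 * ⌈Real.logb α (α / (α - 1))⌉₊ + 3 : ℕ) : ℕ∞) := by
  set k := ⌈Real.logb α (α / (α - 1))⌉₊ with hk
  have hα0 : 0 < α := by linarith
  have hα1 : 0 < α - 1 := by linarith
  have hgt : 1 < α / (α - 1) := by rw [lt_div_iff₀ hα1]; linarith
  -- The logarithm is positive, so the natural-number ceiling agrees with the usual one.
  have hk1 : 1 ≤ k := Nat.ceil_pos.mpr (Real.logb_pos hα hgt)
  have hαk : α ^ (-(k : ℤ)) ≤ 1 - α ^ (-1 : ℤ) := by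
    have h1 : α / (α - 1) ≤ α ^ k := by
      have := (Real.logb_le_iff_le_rpow hα (by positivity)).mp
        (Nat.le_ceil (Real.logb α (α / (α - 1))))
      rwa [Real.rpow_natCast] at this
    have h2 := inv_anti₀ (by positivity) h1
    rw [zpow_neg, zpow_natCast, zpow_neg_one]
    refine h2.trans_eq ?_
    field_simp
  refine iInf₂_le (2 * k + 3) ?_
  by_contra hH
  obtain ⟨Q, hcard, hQ, hempty⟩ := exists_empty_finset_of_not_hellyProperty
    (fun T hT _ => finite_expLattice_inter_convexHull hα hT) hH
  obtain ⟨Q', hQ', hE⟩ := exists_isEmptyConfig hα Q hQ hempty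
  have := hE.card_le hα hk1 hαk
  omega
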